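/- Let $\mathscr A$ be an abelian category with (set-indexed) coproducts. A pair $(\mathscr X,\mathscr Y)$ of additive subcategories (full, closed under isomorphisms and finite direct sums) is *balanced* if $\mathscr X$ is contravariantly finite, $\mathscr Y$ is covariantly finite, every object $M$ has a left $\mathscr X$-resolution $\cdots\to X_1\to X_0\to M\to 0$ (all $X_i\in\mathscr X$, acyclic under $\mathrm{Hom}(X,-)$ for all $X\in\mathscr X$) that is also acyclic under $\mathrm{Hom}(-,Y)$ for all $Y\in\mathscr Y$, and every object $N$ has a right $\mathscr Y$-coresolution $0\to N\to Y^0\to Y^1\to\cdots$ (all $Y^i\in\mathscr Y$, acyclic under $\mathrm{Hom}(-,Y)$ for all $Y\in\mathscr Y$) that is also acyclic under $\mathrm{Hom}(X,-)$ for all $X\in\mathscr X$. It is *admissible* if moreover every right $\mathscr X$-approximation is an epimorphism, where a right $\mathscr X$-approximation of $M$ is a morphism $X\to M$ with $X\in\mathscr X$ through which every morphism $X'\to M$ with $X'\in\mathscr X$ factors. Fix an admissible balanced pair $(\mathscr X,\mathscr Y)$. A sequence is *$\mathscr X$-exact* if it becomes exact under $\mathrm{Hom}(X,-)$ for all $X\in\mathscr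 X$. Let $\mathrm{Ext}^i_{\mathscr X}(M,N)=H^i(\mathrm{Hom}(X_\bullet,N))$, where $X_\bullet$ is a deleted left $\mathscr X$-resolution of $M$, and let $\mathscr X\text{-}\dim M\in\mathbb N\cup\{\infty\}$ be the least length $m$ of a left $\mathscr X$-resolution $0\to X_m\to\cdots\to X_0\to M\to0$. For an object $T$ let $\mathrm{Add}\,T$ be the class of direct summands of coproducts $T^{(I)}$, $I$ a set; let $T^{\mathscr X\perp}=\{M\mid \mathrm{Ext}^i_{\mathscr X}(T,M)=0\text{ for all } i\ge1\}$; and let $\mathrm{Pres}^n_{\mathscr X}T$ be the class of all $L$ for which there is an $\mathscr X$-exact sequence $T_n\to\cdots\to T_1\to L\to0$ with all $T_i\in\mathrm{Add}\,T$. The object $T$ is *$n$-$\mathscr X$-tilting* (with respect to $(\mathscr X,\mathscr Y)$) if 1. $\mathscr X\text{-}\dim T\le n$; 2. $\mathrm{Ext}^i_{\mathscr X}(T,T^{(I)})=0$ for all $i>0$ and all sets $I$; 3. for every $X\in\mathscr X$ there is an $\mathscr X$-exact sequence $0\to X\to T_0\to\cdots\to T_n\to0$ with all $T_i\in\mathrm{Add}\,T$.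 **Theorem.** Let $n\ge1$ be an integer and $T$ an object of $\mathscr A$. Then $T$ is $n$-$\mathscr X$-tilting if and only if $\mathrm{Pres}^n_{\mathscr X}T=T^{\mathscr X\perp}$. -/

import Mathlib

open CategoryTheory Limits

universe v u

noncomputable section

namespace RelTilting

variable {C : Type u} [Category.{v} C] [Abelian C]

/-- `𝒳` (a class of objects, regarded as a full subcategory) is an additive subcategory: it is
closed under isomorphisms and contains zero objects and finite direct sums. -/
structure IsAdditiveSubcategory (𝒳 : ObjectProperty C) : Prop where
  iso_mem : ∀ ⦃A B : C⦄, (A ≅ B) → 𝒳 A → 𝒳 B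
  zero_mem : ∀ ⦃A : C⦄, IsZero A → 𝒳 A
  biprod_mem : ∀ ⦃A B : C⦄, 𝒳 A → 𝒳 B → 𝒳 (A ⊞ B)

/-- The complex of abelian groups `Hom(A, K)`. -/
abbrev homFrom {ι : Type} {c : ComplexShape ι} (A : C) (K : HomologicalComplex C c) :
    HomologicalComplex AddCommGrpCat.{v} c :=
  ((preadditiveCoyoneda.obj (Opposite.op A)).mapHomologicalComplex c).obj K

/-- The complex of abelian groups `Hom(K, B)`. -/
abbrev homInto {ι : Type} {c : ComplexShape ι} (K : HomologicalComplex C c) (B : C) :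
    HomologicalComplex AddCommGrpCat.{v} c.symm :=
  ((preadditiveYoneda.obj B).mapHomologicalComplex c.symm).obj K.op

/-- `Hom(A, K)` is exact in degree `i` for all `A ∈ 𝒳`. -/
def HomFromExactAt {ι : Type} {c : ComplexShape ι} (𝒳 : ObjectProperty C)
    (K : HomologicalComplex C c) (i : ι) : Prop :=
  ∀ A : C, 𝒳 A → (homFrom A K).ExactAt i

/-- `K` is `𝒳`-acyclic (or `𝒳`-exact): `Hom(A, K)` is acyclic for all `A ∈ 𝒳`. -/
def HomFromAcyclic {ι : Type} {c : ComplexShape ι} (𝒳 : ObjectProperty C)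
    (K : HomologicalComplex C c) : Prop :=
  ∀ i, HomFromExactAt 𝒳 K i

/-- `Hom(K, B)` is acyclic for all `B ∈ 𝒴`. -/
def HomIntoAcyclic {ι : Type} {c : ComplexShape ι} (𝒴 : ObjectProperty C)
    (K : HomologicalComplex C c) : Prop :=
  ∀ B : C, 𝒴 B → ∀ i, (homInto K B).ExactAt i

/-- `f : A ⟶ M` is a right `𝒳`-approximation of `M`. -/
def IsRightApprox (𝒳 : ObjectProperty C) {A M : C} (f : A ⟶ M) : Prop :=
  𝒳 A ∧ ∀ A' : C, 𝒳 A' → ∀ g : A' ⟶ M, ∃ k : A' ⟶ A, k ≫ f = g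

/-- `f : M ⟶ B` is a left `𝒴`-approximation of `M`. -/
def IsLeftApprox (𝒴 : ObjectProperty C) {M B : C} (f : M ⟶ B) : Prop :=
  𝒴 B ∧ ∀ B' : C, 𝒴 B' → ∀ g : M ⟶ B', ∃ k : B ⟶ B', f ≫ k = g

def ContravariantlyFinite (𝒳 : ObjectProperty C) : Prop :=
  ∀ M : C, ∃ (A : C) (f : A ⟶ M), IsRightApprox 𝒳 f

def CovariantlyFinite (𝒴 : ObjectProperty C) : Prop :=
  ∀ M : C, ∃ (B : C) (f : M ⟶ B), IsLeftApprox 𝒴 f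

/-- A left `𝒳`-resolution `⋯ ⟶ X₁ ⟶ X₀ ⟶ M ⟶ 0`. The augmented complex is stored as one chain
complex: `M` sits in degree `0` and `Xᵢ` in degree `i + 1`. Exactness of `Hom(A, -)` in degree `0`
says that `Hom(A, X₀) ⟶ Hom(A, M)` is surjective. -/
structure LeftResolution (𝒳 : ObjectProperty C) (M : C) where
  complex : ChainComplex C ℕ
  iso : complex.X 0 ≅ M
  mem : ∀ i, 𝒳 (complex.X (i + 1))
  acyclic : HomFromAcyclic 𝒳 complex

/-- The deleted resolution `⋯ ⟶ X₁ ⟶ X₀ ⟶ 0`, with `Xᵢ` in degree `i`. -/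
def LeftResolution.deleted {𝒳 : ObjectProperty C} {M : C} (P : LeftResolution 𝒳 M) :
    ChainComplex C ℕ :=
  ChainComplex.truncate.obj P.complex

/-- A right `𝒴`-coresolution `0 ⟶ N ⟶ Y⁰ ⟶ Y¹ ⟶ ⋯`, with `N` in degree `0` and `Yⁱ` in degree
`i + 1`; it is acyclic under `Hom(-, B)` for all `B ∈ 𝒴`. -/
structure RightCoresolution (𝒴 : ObjectProperty C) (N : C) where
  complex : CochainComplex C ℕ
  iso : complex.X 0 ≅ N
  mem : ∀ i, 𝒴 (complex.X (i + 1))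
  acyclic : HomIntoAcyclic 𝒴 complex

/-- Balanced pairs of additive subcategories. -/
structure IsBalancedPair (𝒳 𝒴 : ObjectProperty C) : Prop where
  additive_left : IsAdditiveSubcategory 𝒳
  additive_right : IsAdditiveSubcategory 𝒴
  contravariantlyFinite : ContravariantlyFinite 𝒳
  covariantlyFinite : CovariantlyFinite 𝒴
  exists_resolution : ∀ M : C, ∃ P : LeftResolution 𝒳 M, HomIntoAcyclic 𝒴 P.complex
  exists_coresolution : ∀ N : C, ∃ Q : RightCoresolution 𝒴 N, HomFromAcyclic 𝒳 Q.complex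

/-- A balanced pair `(𝒳, 𝒴)` is admissible if every right `𝒳`-approximation is an epimorphism. -/
structure IsAdmissibleBalancedPair (𝒳 𝒴 : ObjectProperty C) : Prop
    extends IsBalancedPair 𝒳 𝒴 where
  epi_of_isRightApprox : ∀ ⦃A M : C⦄ (f : A ⟶ M), IsRightApprox 𝒳 f → Epi f

section Ext

variable {𝒳 𝒴 : ObjectProperty C}

/-- A left `𝒳`-resolution of `M` which stays acyclic under `Hom(-, B)` for all `B ∈ 𝒴`. -/
def IsAdmissibleBalancedPair.resolution (h : IsAdmissibleBalancedPair 𝒳 𝒴) (M : C) :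
    LeftResolution 𝒳 M :=
  (h.exists_resolution M).choose

/-- The relative extension group `Ext^i_𝒳(M, N) = H^i(Hom(X_•, N))`, where `X_•` is a deleted left
`𝒳`-resolution of `M`. -/
def relExt (h : IsAdmissibleBalancedPair 𝒳 𝒴) (i : ℕ) (M N : C) : AddCommGrpCat.{v} :=
  (homInto (h.resolution M).deleted N).homology i

/-- The class `T^{𝒳⊥}` of all `M` with `Ext^i_𝒳(T, M) = 0` for all `i ≥ 1`. -/
def relPerp (h : IsAdmissibleBalancedPair 𝒳 𝒴) (T : C) : ObjectProperty C :=
  fun M ↦ ∀ i : ℕ, 1 ≤ i → IsZero (relExt h i T M)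

end Ext

/-- The left `𝒳`-dimension of `M`: the least `n` such that there is a left `𝒳`-resolution
`0 ⟶ Xₙ ⟶ ⋯ ⟶ X₀ ⟶ M ⟶ 0`, and `⊤` if there is no such `n`. -/
def leftDim (𝒳 : ObjectProperty C) (M : C) : ℕ∞ :=
  sInf {m | ∃ n : ℕ, m = (n : ℕ∞) ∧
    ∃ P : LeftResolution 𝒳 M, ∀ i, n < i → IsZero (P.deleted.X i)}

variable [HasCoproducts.{v} C]

/-- `Add T`: direct summands of coproducts `T^{(I)}` of copies of `T`. -/
def addClosure (T : C) : ObjectProperty C :=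
  fun K ↦ ∃ (J : C) (I : Type v), Nonempty (K ⊞ J ≅ ∐ fun _ : I ↦ T)

/-- `Pres^n_𝒳 T`: the objects `L` for which there is an `𝒳`-exact sequence
`Tₙ ⟶ ⋯ ⟶ T₁ ⟶ L ⟶ 0` with all `Tᵢ ∈ Add T`. Here `L` sits in degree `0`, `Tᵢ` in degree `i`, and
there is no condition in the last degree `n`. -/
def relPres (𝒳 : ObjectProperty C) (n : ℕ) (T : C) : ObjectProperty C :=
  fun L ↦ ∃ K : ChainComplex C ℕ, Nonempty (K.X 0 ≅ L) ∧
    (∀ i, 1 ≤ i → i ≤ n → addClosure T (K.X i)) ∧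
    (∀ i, n < i → IsZero (K.X i)) ∧
    ∀ i, i < n → HomFromExactAt 𝒳 K i

/-- `T` is `n`-`𝒳`-tilting with respect to the admissible balanced pair `(𝒳, 𝒴)`. In `coresolution`
the complex `K` is `0 ⟶ A ⟶ T₀ ⟶ ⋯ ⟶ Tₙ ⟶ 0`, with `A` in degree `0` and `Tᵢ` in degree `i + 1`. -/
structure IsTilting {𝒳 𝒴 : ObjectProperty C} (h : IsAdmissibleBalancedPair 𝒳 𝒴) (n : ℕ)
    (T : C) : Prop where
  dim_le : leftDim 𝒳 T ≤ (n : ℕ∞)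
  selfOrthogonal : ∀ (I : Type v) (i : ℕ), 0 < i → IsZero (relExt h i T (∐ fun _ : I ↦ T))
  coresolution : ∀ A : C, 𝒳 A → ∃ K : CochainComplex C ℕ, Nonempty (K.X 0 ≅ A) ∧
    (∀ i, i ≤ n → addClosure T (K.X (i + 1))) ∧
    (∀ i, n < i → IsZero (K.X (i + 1))) ∧
    HomFromAcyclic 𝒳 K

end RelTilting

end

open scoped ZeroObject

noncomputable section

namespace RelTilting

section

/-! Vanishing of relative `Ext` is treated as a lifting property. Balance supplies relative
projective covers from `𝒳` and relative injective hulls from `𝒴`, so dimension shifting works in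
either variable.

Let `T` be tilting. An object with an `n`-step presentation by `Add T` is orthogonal to `T`, because
`Ext^i(T, -) = 0` for `i > n`. Conversely, if `M` is orthogonal to `T`, maps `X ⟶ M` extend along `X
⟶ T₀`; hence the evaluation `T^(Hom(T, M)) ⟶ M` is a relative epimorphism with orthogonal kernel
(`exists_evaluation`), and this iterates.

If the two classes agree, evaluation sequences again exist, and they turn presentations by
orthogonal objects into presentations by `Add T` (`hasLeftChain_of_extPerp`). An `n`-th cosyzygy is
presented by objects of `𝒴`, so it is orthogonal to `T`; thus `Ext^i(T, -) = 0` for `i > n`, and a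
swindle yields a resolution of length `n`. Finally `exists_approximation` embeds `A ∈ 𝒳` into an
orthogonal `M` whose cokernel is finitely coresolved by `Add T`. The evaluation sequence of `M` then
splits, so `M ∈ Add T`. -/

variable {C : Type u} [Category.{v} C] [Abelian C] {𝒳 𝒴 : ObjectProperty C}

/-! ### Relative short exact sequences -/

/-- `A ⟶ B ⟶ D` is a short exact sequence `0 ⟶ A ⟶ B ⟶ D ⟶ 0` which stays exact under `Hom(X, -)`
for all `X ∈ 𝒳`. That `g` is an epimorphism is automatic for admissible balanced pairs. -/
structure IsRelShortExact (𝒳 : ObjectProperty C) {A B D : C} (f : A ⟶ B) (g : B ⟶ D) : Prop where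
  zero : f ≫ g = 0
  mono : Mono f
  factor : ∀ ⦃W : C⦄ (k : W ⟶ B), k ≫ g = 0 → ∃ l : W ⟶ A, l ≫ f = k
  lift : ∀ ⦃W : C⦄, 𝒳 W → ∀ x : W ⟶ D, ∃ y : W ⟶ B, y ≫ g = x

lemma IsRelShortExact.of_kernel {B D : C} (g : B ⟶ D)
    (hg : ∀ ⦃W : C⦄, 𝒳 W → ∀ x : W ⟶ D, ∃ y : W ⟶ B, y ≫ g = x) :
    IsRelShortExact 𝒳 (kernel.ι g) g where
  zero := kernel.condition g
  mono := inferInstance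
  factor _ k hk := ⟨kernel.lift g k hk, kernel.lift_ι _ _ _⟩
  lift := hg

namespace IsAdmissibleBalancedPair

variable (h : IsAdmissibleBalancedPair 𝒳 𝒴)

include h

lemma epi_of_lift {B D : C} (g : B ⟶ D)
    (hg : ∀ ⦃W : C⦄, 𝒳 W → ∀ x : W ⟶ D, ∃ y : W ⟶ B, y ≫ g = x) : Epi g := by
  obtain ⟨P, a, ha⟩ := h.contravariantlyFinite D
  have := h.epi_of_isRightApprox a ha
  obtain ⟨y, hy⟩ := hg ha.1 a
  exact epi_of_epi_fac hy

lemma eq_zero_of_forall {M N : C} (f : M ⟶ N)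
    (hf : ∀ ⦃W : C⦄, 𝒳 W → ∀ x : W ⟶ M, x ≫ f = 0) : f = 0 := by
  obtain ⟨P, a, ha⟩ := h.contravariantlyFinite M
  have := h.epi_of_isRightApprox a ha
  rw [← cancel_epi a, hf ha.1, comp_zero]

variable {A B D : C} {f : A ⟶ B} {g : B ⟶ D}

lemma epi (hS : IsRelShortExact 𝒳 f g) : Epi g := h.epi_of_lift g hS.lift

/-- Admissibility makes `g` an epimorphism, and in an abelian category an epimorphism is the
cokernel of its kernel. -/
lemma desc (hS : IsRelShortExact 𝒳 f g) {N : C} (k : B ⟶ N) (hk : f ≫ k = 0) :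
    ∃ l : D ⟶ N, g ≫ l = k := by
  have := h.epi hS
  have := hS.mono
  have hl : IsLimit (KernelFork.ofι f hS.zero) :=
    KernelFork.IsLimit.ofι' f hS.zero fun k hk ↦ ⟨_, (hS.factor k hk).choose_spec⟩
  obtain ⟨l, hl⟩ := CokernelCofork.IsColimit.desc' (Abelian.epiIsCokernelOfKernel _ hl) k hk
  exact ⟨l, hl⟩

lemma exists_proj_cover (M : C) : ∃ (K P : C) (i : K ⟶ P) (p : P ⟶ M),
    𝒳 P ∧ IsRelShortExact 𝒳 i p := by
  obtain ⟨P, a, ha⟩ := h.contravariantlyFinite M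
  exact ⟨_, P, _, a, ha.1, .of_kernel a ha.2⟩

/-- Maps out of the kernel of `B ⟶ D` extend to `B` if this holds for one short exact sequence
`K ⟶ P ⟶ D` with `P ∈ 𝒳`. -/
lemma extend_of_cover {K P N : C} {i : K ⟶ P} {p : P ⟶ D} (hP : 𝒳 P)
    (hp : IsRelShortExact 𝒳 i p) (hN : ∀ a : K ⟶ N, ∃ b : P ⟶ N, i ≫ b = a)
    (hS : IsRelShortExact 𝒳 f g) (a : A ⟶ N) : ∃ b : B ⟶ N, f ≫ b = a := by
  obtain ⟨u, hu⟩ := hS.lift hP p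
  obtain ⟨c, hc⟩ := hS.factor (i ≫ u) (by rw [Category.assoc, hu, hp.zero])
  obtain ⟨e, he⟩ := hN (c ≫ a)
  have := hp.mono
  have := hS.mono
  -- Comparing the two sequences over `D` presents `B` as the pushout of `c` and `i`, so a
  -- compatible pair of maps on `A` and `P` descends to `B`.
  have hQ : IsRelShortExact 𝒳 (biprod.lift (-c) i) (biprod.desc f u) :=
    { zero := by simp [hc]
      mono := by
        have : Mono (biprod.lift (-c) i ≫ biprod.snd) := by rw [biprod.lift_snd]; exact hp.mono
        exact mono_of_mono _ biprod.snd
      factor := fun W k hk ↦ by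
        have hk' : k ≫ biprod.fst ≫ f + k ≫ biprod.snd ≫ u = 0 := by
          rw [← Preadditive.comp_add, ← biprod.desc_eq, hk]
        have h1 : (k ≫ biprod.snd) ≫ p = 0 := by
          have := congr($hk' ≫ g)
          simpa [hS.zero, hu] using this
        obtain ⟨l, hl⟩ := hp.factor _ h1
        refine ⟨l, ?_⟩
        apply biprod.hom_ext
        · rw [← cancel_mono f]
          simp only [Category.assoc, biprod.lift_fst, Preadditive.neg_comp, Preadditive.comp_neg,
            hc]
          rw [← Category.assoc l, hl, eq_comm, eq_neg_iff_add_eq_zero, Category.assoc, hk']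
        · simpa using hl
      lift := fun W hW x ↦ by
        obtain ⟨y, hy⟩ := hp.lift hW (x ≫ g)
        obtain ⟨z, hz⟩ := hS.factor (x - y ≫ u) (by simp [hu, hy])
        exact ⟨biprod.lift z y, by simp [hz]⟩ }
  obtain ⟨b, hb⟩ := h.desc hQ (biprod.desc a e) (by simp [he])
  exact ⟨b, by simpa using congr(biprod.inl ≫ $hb)⟩

end IsAdmissibleBalancedPair

/-! ### Exactness of Hom complexes, and cycles -/

section Complexes

variable {ι : Type} {c : ComplexShape ι}

lemma homFromExactAt_iff (𝒳 : ObjectProperty C) (K : HomologicalComplex C c) (i j k : ι)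
    (hi : c.prev j = i) (hk : c.next j = k) :
    HomFromExactAt 𝒳 K j ↔ ∀ ⦃W : C⦄, 𝒳 W → ∀ x : W ⟶ K.X j, x ≫ K.d j k = 0 →
      ∃ y : W ⟶ K.X i, y ≫ K.d i j = x := by
  refine forall_congr' fun W ↦ forall_congr' fun hW ↦ ?_
  rw [HomologicalComplex.exactAt_iff' _ i j k hi hk, ShortComplex.ab_exact_iff]
  rfl

lemma homInto_exactAt_iff (K : HomologicalComplex C c) (B : C) (i j k : ι)
    (hi : c.next j = i) (hk : c.prev j = k) :
    (homInto K B).ExactAt j ↔ ∀ x : K.X j ⟶ B, K.d k j ≫ x = 0 →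
      ∃ y : K.X i ⟶ B, K.d j i ≫ y = x := by
  rw [HomologicalComplex.exactAt_iff' (homInto K B) i j k hi hk, ShortComplex.ab_exact_iff]
  rfl

/-- The short exact sequence `Zᵢ ⟶ Kᵢ ⟶ Zⱼ` of cycles. -/
lemma isRelShortExact_cycles {K : HomologicalComplex C c} {i j k : ι} (hij : c.Rel i j)
    (hk : c.next j = k) (hK : HomFromExactAt 𝒳 K j) :
    IsRelShortExact 𝒳 (K.iCycles i) (K.toCycles i j) := by
  rw [homFromExactAt_iff 𝒳 K i j k (c.prev_eq' hij) hk] at hK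
  have hz : ∀ {W : C} (x : W ⟶ K.X i), x ≫ K.toCycles i j = 0 ↔ x ≫ K.d i j = 0 := fun x ↦ by
    rw [← cancel_mono (K.iCycles j), Category.assoc, K.toCycles_i, zero_comp]
  exact
    { zero := by rw [hz, K.iCycles_d]
      mono := inferInstance
      factor := fun W x hx ↦ ⟨K.liftCycles x j (c.next_eq' hij) ((hz x).1 hx),
        K.liftCycles_i _ _ _ _⟩
      lift := fun W hW x ↦ by
        obtain ⟨y, hy⟩ := hK hW (x ≫ K.iCycles j) (by rw [Category.assoc, K.iCycles_d, comp_zero])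
        exact ⟨y, by rw [← cancel_mono (K.iCycles j), Category.assoc, K.toCycles_i, hy]⟩ }

end Complexes

/-! ### Vanishing of relative Ext as a lifting property -/

/-- Vanishing of `Ext¹_𝒳(M, N)`: maps out of `M` lift along `E ⟶ F` for every relative short exact
sequence `N ⟶ E ⟶ F`. -/
def ExtOneVanishes (𝒳 : ObjectProperty C) (M N : C) : Prop :=
  ∀ ⦃E F : C⦄ (f : N ⟶ E) (g : E ⟶ F), IsRelShortExact 𝒳 f g →
    ∀ x : M ⟶ F, ∃ y : M ⟶ E, y ≫ g = x

/-- Vanishing of `Ext^(k+1)_𝒳(M, N)`, by dimension shifting in the first variable. -/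
def ExtVanishes (𝒳 : ObjectProperty C) : ℕ → C → C → Prop
  | 0, M, N => ExtOneVanishes 𝒳 M N
  | k + 1, M, N => ∀ ⦃K P : C⦄ (i : K ⟶ P) (p : P ⟶ M), 𝒳 P → IsRelShortExact 𝒳 i p →
      ExtVanishes 𝒳 k K N

lemma extOneVanishes_of_mem {M : C} (hM : 𝒳 M) (N : C) : ExtOneVanishes 𝒳 M N :=
  fun _ _ _ _ hS ↦ hS.lift hM

lemma ExtOneVanishes.retract {M M' N : C} (hM : ExtOneVanishes 𝒳 M N) (i : M' ⟶ M) (r : M ⟶ M')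
    (hi : i ≫ r = 𝟙 M') : ExtOneVanishes 𝒳 M' N := fun E F f g hS x ↦ by
  obtain ⟨y, hy⟩ := hM f g hS (r ≫ x)
  exact ⟨i ≫ y, by rw [Category.assoc, hy, reassoc_of% hi]⟩

lemma ExtOneVanishes.sigma {I : Type*} {M : I → C} [HasCoproduct M] {N : C}
    (hM : ∀ i, ExtOneVanishes 𝒳 (M i) N) : ExtOneVanishes 𝒳 (∐ M) N := fun E F f g hS x ↦ by
  choose y hy using fun i ↦ hM i f g hS (Sigma.ι M i ≫ x)
  exact ⟨Sigma.desc y, by ext i; simp [hy]⟩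

lemma isRelShortExact_cycles_chain {K : ChainComplex C ℕ} {j : ℕ} (hK : HomFromExactAt 𝒳 K j) :
    IsRelShortExact 𝒳 (K.iCycles (j + 1)) (K.toCycles (j + 1) j) :=
  isRelShortExact_cycles (by simp) rfl hK

/-- The `0`-cycles of a chain complex are everything. -/
def cyclesZeroIso (K : ChainComplex C ℕ) : K.cycles 0 ≅ K.X 0 where
  hom := K.iCycles 0
  inv := K.liftCycles (𝟙 _) 0 (by simp) (by simp)
  hom_inv_id := by rw [← cancel_mono (K.iCycles 0)]; simp
  inv_hom_id := by simp

lemma IsRelShortExact.comp_iso {A B D D' : C} {f : A ⟶ B} {g : B ⟶ D}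
    (hS : IsRelShortExact 𝒳 f g) (e : D ≅ D') : IsRelShortExact 𝒳 f (g ≫ e.hom) where
  zero := by rw [reassoc_of% hS.zero, zero_comp]
  mono := hS.mono
  factor W k hk := hS.factor k (by
    rwa [← Category.assoc, Preadditive.IsIso.comp_right_eq_zero] at hk)
  lift W hW x := by
    obtain ⟨y, hy⟩ := hS.lift hW (x ≫ e.inv)
    exact ⟨y, by rw [reassoc_of% hy, e.inv_hom_id, Category.comp_id]⟩

lemma IsRelShortExact.iso_comp {A A' B D : C} {f : A ⟶ B} {g : B ⟶ D}
    (hS : IsRelShortExact 𝒳 f g) (e : A' ≅ A) : IsRelShortExact 𝒳 (e.hom ≫ f) g where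
  zero := by rw [Category.assoc, hS.zero, comp_zero]
  mono := by have := hS.mono; infer_instance
  factor W k hk := by
    obtain ⟨l, hl⟩ := hS.factor k hk
    exact ⟨l ≫ e.inv, by simpa using hl⟩
  lift := hS.lift

/-! ### Balance: relative injectivity of `𝒴` -/

namespace IsAdmissibleBalancedPair

variable (h : IsAdmissibleBalancedPair 𝒳 𝒴)

include h

/-- By relative exactness, the `j`-cycles are the cokernel of `K_(j+2) ⟶ K_(j+1)`, so cocycles in
degree `j + 1` are maps out of `K.cycles j`; coboundaries are those that extend to `K_j`. -/
lemma homInto_exactAt_succ_iff {K : ChainComplex C ℕ} {j : ℕ} (h₁ : HomFromExactAt 𝒳 K j)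
    (h₂ : HomFromExactAt 𝒳 K (j + 1)) (N : C) :
    (homInto K N).ExactAt (j + 1) ↔
      ∀ a : K.cycles j ⟶ N, ∃ b : K.X j ⟶ N, K.iCycles j ≫ b = a := by
  rw [homInto_exactAt_iff K N j (j + 1) (j + 2) (by simp) (by simp)]
  have s₁ := isRelShortExact_cycles_chain h₁
  have s₂ := isRelShortExact_cycles_chain h₂
  have := h.epi s₁
  have := h.epi s₂
  constructor
  · intro H a
    obtain ⟨b, hb⟩ := H (K.toCycles (j + 1) j ≫ a) (by simp)
    exact ⟨b, by rw [← cancel_epi (K.toCycles (j + 1) j), ← hb, K.toCycles_i_assoc]⟩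
  · intro H x hx
    obtain ⟨a, ha⟩ := h.desc s₁ x (by
      rw [← cancel_epi (K.toCycles (j + 2) (j + 1)), K.toCycles_i_assoc, hx, comp_zero])
    obtain ⟨b, hb⟩ := H a
    exact ⟨b, by rw [← ha, ← hb, K.toCycles_i_assoc]⟩

/-- Objects of `𝒴` are injective with respect to relative short exact sequences. -/
lemma extend_of_mem {Y A B D : C} (hY : 𝒴 Y) {f : A ⟶ B} {g : B ⟶ D}
    (hS : IsRelShortExact 𝒳 f g) (a : A ⟶ Y) : ∃ b : B ⟶ Y, f ≫ b = a := by
  obtain ⟨P, hP⟩ := h.exists_resolution D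
  let e : P.complex.cycles 0 ≅ D := cyclesZeroIso P.complex ≪≫ P.iso
  have s := isRelShortExact_cycles_chain (P.acyclic 0)
  refine h.extend_of_cover (i := P.complex.iCycles 1) (p := P.complex.toCycles 1 0 ≫ e.hom)
    (P.mem 0) ?_ ?_ hS a
  · exact s.comp_iso e
  -- Balance enters here: the resolution is also acyclic under `Hom(-, Y)`. Degree `2` holds the
  -- term `X₁`, as `D` sits in degree `0`.
  · exact (h.homInto_exactAt_succ_iff (P.acyclic 1) (P.acyclic 2) Y).1 (hP Y hY 2)

lemma nonempty_cycles_one_iso {K : CochainComplex C ℕ} (h₀ : HomFromExactAt 𝒳 K 0)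
    (h₁ : HomFromExactAt 𝒳 K 1) : Nonempty (K.cycles 1 ≅ K.X 0) := by
  rw [homFromExactAt_iff 𝒳 K 0 0 1 (by simp) (by simp)] at h₀
  have s := isRelShortExact_cycles (i := 0) (j := 1) (by simp) rfl h₁
  have hz : K.iCycles 0 = 0 := by
    refine h.eq_zero_of_forall _ fun W hW x ↦ ?_
    obtain ⟨y, hy⟩ := h₀ hW (x ≫ K.iCycles 0) (by simp)
    rw [← hy, K.shape _ _ (by simp), comp_zero]
  have := h.epi s
  have : Mono (K.toCycles 0 1) := by
    refine Preadditive.mono_of_cancel_zero _ fun k hk ↦ ?_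
    obtain ⟨l, hl⟩ := s.factor k hk
    rw [← hl, hz, comp_zero]
  have : IsIso (K.toCycles 0 1) := isIso_of_mono_of_epi _
  exact ⟨(asIso (K.toCycles 0 1)).symm⟩

lemma exists_inj_hull (N : C) : ∃ (Y Z : C) (f : N ⟶ Y) (g : Y ⟶ Z),
    𝒴 Y ∧ IsRelShortExact 𝒳 f g := by
  obtain ⟨Q, hQ⟩ := h.exists_coresolution N
  obtain ⟨e⟩ := h.nonempty_cycles_one_iso (hQ 0) (hQ 1)
  have s := isRelShortExact_cycles (i := 1) (j := 2) (by simp) rfl (hQ 2)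
  exact ⟨_, _, _, _, Q.mem 0, s.iso_comp (e ≪≫ Q.iso).symm⟩

/-! ### Dimension shifting and fragments of the long exact sequences -/

variable {A B D M N : C} {f : A ⟶ B} {g : B ⟶ D}

/-- If maps from `D` lift along one relative short exact sequence `N ⟶ Y ⟶ Z` with `Y ∈ 𝒴`, then
maps to `N` extend along any relative monomorphism with cokernel `D`. -/
lemma extend_of_hull {Y Z : C} {j : N ⟶ Y} {q : Y ⟶ Z} (hY : 𝒴 Y) (hq : IsRelShortExact 𝒳 j q)
    (hD : ∀ x : D ⟶ Z, ∃ y : D ⟶ Y, y ≫ q = x) (hS : IsRelShortExact 𝒳 f g) (a : A ⟶ N) :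
    ∃ b : B ⟶ N, f ≫ b = a := by
  obtain ⟨b, hb⟩ := h.extend_of_mem hY hS (a ≫ j)
  obtain ⟨c, hc⟩ := h.desc hS (b ≫ q) (by rw [reassoc_of% hb, hq.zero, comp_zero])
  obtain ⟨d, hd⟩ := hD c
  obtain ⟨l, hl⟩ := hq.factor (b - g ≫ d) (by simp [hd, hc])
  have := hq.mono
  refine ⟨l, ?_⟩
  rw [← cancel_mono j, Category.assoc, hl, Preadditive.comp_sub, hb, reassoc_of% hS.zero, zero_comp,
    sub_zero]

lemma extOneVanishes_extend (hD : ExtOneVanishes 𝒳 D N) (hS : IsRelShortExact 𝒳 f g)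
    (a : A ⟶ N) : ∃ b : B ⟶ N, f ≫ b = a := by
  obtain ⟨Y, Z, j, q, hY, hq⟩ := h.exists_inj_hull N
  exact h.extend_of_hull hY hq (hD j q hq) hS a

/-- A map out of `D` lifts after composing with `g`, since `B ∈ 𝒳`; the extension property corrects
this lift so that it kills `A` and descends to `D`. -/
lemma extOneVanishes_of_extend (hB : 𝒳 B) (hS : IsRelShortExact 𝒳 f g)
    (hN : ∀ a : A ⟶ N, ∃ b : B ⟶ N, f ≫ b = a) : ExtOneVanishes 𝒳 D N := by
  intro E F i p hip x
  obtain ⟨y, hy⟩ := hip.lift hB (g ≫ x)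
  obtain ⟨c, hc⟩ := hip.factor (f ≫ y) (by rw [Category.assoc, hy, reassoc_of% hS.zero, zero_comp])
  obtain ⟨b, hb⟩ := hN c
  obtain ⟨l, hl⟩ := h.desc hS (y - b ≫ i) (by
    rw [Preadditive.comp_sub, ← hc, reassoc_of% hb, sub_self])
  have := h.epi hS
  refine ⟨l, ?_⟩
  rw [← cancel_epi g, reassoc_of% hl, Preadditive.sub_comp, hy, Category.assoc, hip.zero, comp_zero,
    sub_zero]

lemma extOneVanishes_iff_extend (hB : 𝒳 B) (hS : IsRelShortExact 𝒳 f g) :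
    ExtOneVanishes 𝒳 D N ↔ ∀ a : A ⟶ N, ∃ b : B ⟶ N, f ≫ b = a :=
  ⟨fun hD ↦ h.extOneVanishes_extend hD hS, h.extOneVanishes_of_extend hB hS⟩

lemma extOneVanishes_of_hull {Y Z : C} {j : N ⟶ Y} {q : Y ⟶ Z} (hY : 𝒴 Y)
    (hq : IsRelShortExact 𝒳 j q) (hD : ∀ x : D ⟶ Z, ∃ y : D ⟶ Y, y ≫ q = x) :
    ExtOneVanishes 𝒳 D N := by
  obtain ⟨K, P, i, p, hP, hp⟩ := h.exists_proj_cover D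
  exact h.extOneVanishes_of_extend hP hp (h.extend_of_hull hY hq hD hp)

lemma extOneVanishes_right_of_mem {Y : C} (hY : 𝒴 Y) (M : C) : ExtOneVanishes 𝒳 M Y := by
  obtain ⟨K, P, i, p, hP, hp⟩ := h.exists_proj_cover M
  exact h.extOneVanishes_of_extend hP hp (h.extend_of_mem hY hp)

/-- `Ext²(M, N)` can be computed by shifting either variable. -/
lemma extOneVanishes_shift {K P Y Z : C} {i : K ⟶ P} {p : P ⟶ M} {j : N ⟶ Y} {q : Y ⟶ Z}
    (hP : 𝒳 P) (hp : IsRelShortExact 𝒳 i p) (hY : 𝒴 Y) (hq : IsRelShortExact 𝒳 j q) :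
    ExtOneVanishes 𝒳 M Z ↔ ExtOneVanishes 𝒳 K N := by
  constructor
  · intro H
    refine h.extOneVanishes_of_hull hY hq fun x ↦ ?_
    obtain ⟨b, hb⟩ := h.extOneVanishes_extend H hp x
    obtain ⟨y, hy⟩ := hq.lift hP b
    exact ⟨i ≫ y, by rw [Category.assoc, hy, hb]⟩
  · intro H
    refine h.extOneVanishes_of_extend hP hp fun a ↦ ?_
    obtain ⟨y, hy⟩ := H j q hq a
    obtain ⟨b, hb⟩ := h.extend_of_mem hY hp y
    exact ⟨b ≫ q, by rw [reassoc_of% hb, hy]⟩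

lemma extVanishes_succ_iff_right (k : ℕ) {M N Y Z : C} {j : N ⟶ Y} {q : Y ⟶ Z} (hY : 𝒴 Y)
    (hq : IsRelShortExact 𝒳 j q) : ExtVanishes 𝒳 (k + 1) M N ↔ ExtVanishes 𝒳 k M Z := by
  induction k generalizing M with
  | zero =>
    obtain ⟨K, P, i, p, hP, hp⟩ := h.exists_proj_cover M
    exact ⟨fun H ↦ (h.extOneVanishes_shift hP hp hY hq).2 (H i p hP hp),
      fun H K P i p hP hp ↦ (h.extOneVanishes_shift hP hp hY hq).1 H⟩
  | succ k ih => exact forall₄_congr fun K P i p ↦ forall₂_congr fun _ _ ↦ ih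

/-- The definition quantifies over all covers. Shifting in the second variable instead involves no
cover, which shows that a single one suffices. -/
lemma extVanishes_succ_iff_left (k : ℕ) {M N K P : C} {i : K ⟶ P} {p : P ⟶ M} (hP : 𝒳 P)
    (hp : IsRelShortExact 𝒳 i p) : ExtVanishes 𝒳 (k + 1) M N ↔ ExtVanishes 𝒳 k K N := by
  induction k generalizing N with
  | zero =>
    obtain ⟨Y, Z, j, q, hY, hq⟩ := h.exists_inj_hull N
    rw [h.extVanishes_succ_iff_right 0 hY hq]
    exact h.extOneVanishes_shift hP hp hY hq
  | succ k ih =>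
    obtain ⟨Y, Z, j, q, hY, hq⟩ := h.exists_inj_hull N
    rw [h.extVanishes_succ_iff_right _ hY hq, h.extVanishes_succ_iff_right _ hY hq, ih]

/-- Shifting in the second variable keeps `M` fixed, so no compatible covers of `M` and `M'` are
needed. The same device handles coproducts, under which `𝒳` need not be closed. -/
lemma extVanishes_retract (k : ℕ) {M M' N : C} (hM : ExtVanishes 𝒳 k M N) (i : M' ⟶ M) (r : M ⟶ M')
    (hi : i ≫ r = 𝟙 M') : ExtVanishes 𝒳 k M' N := by
  induction k generalizing N with
  | zero => exact ExtOneVanishes.retract hM i r hi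
  | succ k ih =>
    obtain ⟨Y, Z, j, q, hY, hq⟩ := h.exists_inj_hull N
    rw [h.extVanishes_succ_iff_right _ hY hq] at hM ⊢
    exact ih hM

lemma extVanishes_sigma (k : ℕ) {I : Type*} {M : I → C} [HasCoproduct M] {N : C}
    (hM : ∀ i, ExtVanishes 𝒳 k (M i) N) : ExtVanishes 𝒳 k (∐ M) N := by
  induction k generalizing N with
  | zero => exact ExtOneVanishes.sigma hM
  | succ k ih =>
    obtain ⟨Y, Z, j, q, hY, hq⟩ := h.exists_inj_hull N
    simp only [h.extVanishes_succ_iff_right _ hY hq] at hM ⊢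
    exact ih hM

lemma extVanishes_of_mem (k : ℕ) (hM : 𝒳 M) (N : C) : ExtVanishes 𝒳 k M N := by
  induction k generalizing N with
  | zero => exact extOneVanishes_of_mem hM N
  | succ k ih =>
    obtain ⟨Y, Z, j, q, hY, hq⟩ := h.exists_inj_hull N
    rw [h.extVanishes_succ_iff_right _ hY hq]
    exact ih Z

lemma extVanishes_right_of_mem (k : ℕ) {Y : C} (hY : 𝒴 Y) (M : C) : ExtVanishes 𝒳 k M Y := by
  induction k generalizing M with
  | zero => exact h.extOneVanishes_right_of_mem hY M
  | succ k ih => exact fun K P i p _ _ ↦ ih K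

lemma extVanishes_middle (k : ℕ) (hS : IsRelShortExact 𝒳 f g) (hA : ExtVanishes 𝒳 k M A)
    (hD : ExtVanishes 𝒳 k M D) : ExtVanishes 𝒳 k M B := by
  induction k generalizing M with
  | zero =>
    obtain ⟨K, P, i, p, hP, hp⟩ := h.exists_proj_cover M
    refine h.extOneVanishes_of_extend hP hp fun a ↦ ?_
    obtain ⟨b, hb⟩ := h.extOneVanishes_extend hD hp (a ≫ g)
    obtain ⟨y, hy⟩ := hS.lift hP b
    obtain ⟨l, hl⟩ := hS.factor (a - i ≫ y) (by simp [hy, hb])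
    obtain ⟨m, hm⟩ := h.extOneVanishes_extend hA hp l
    exact ⟨m ≫ f + y, by rw [Preadditive.comp_add, reassoc_of% hm, hl, sub_add_cancel]⟩
  | succ k ih => exact fun K P i p hP hp ↦ ih (hA i p hP hp) (hD i p hP hp)

lemma extVanishes_quotient (k : ℕ) (hS : IsRelShortExact 𝒳 f g) (hB : ExtVanishes 𝒳 k M B)
    (hA : ExtVanishes 𝒳 (k + 1) M A) : ExtVanishes 𝒳 k M D := by
  induction k generalizing M with
  | zero =>
    obtain ⟨K, P, i, p, hP, hp⟩ := h.exists_proj_cover M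
    refine h.extOneVanishes_of_extend hP hp fun a ↦ ?_
    obtain ⟨y, hy⟩ := hA i p hP hp f g hS a
    obtain ⟨b, hb⟩ := h.extOneVanishes_extend hB hp y
    exact ⟨b ≫ g, by rw [reassoc_of% hb, hy]⟩
  | succ k ih => exact fun K P i p hP hp ↦ ih (hB i p hP hp) (hA i p hP hp)

/-- `Ext¹(M, A) = 0` if `Ext¹(M, B) = 0` and `Hom(M, B) ⟶ Hom(M, D)` is surjective. -/
lemma extOneVanishes_sub (hS : IsRelShortExact 𝒳 f g) (hB : ExtOneVanishes 𝒳 M B)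
    (hM : ∀ x : M ⟶ D, ∃ y : M ⟶ B, y ≫ g = x) : ExtOneVanishes 𝒳 M A := by
  obtain ⟨K, P, i, p, hP, hp⟩ := h.exists_proj_cover M
  refine h.extOneVanishes_of_extend hP hp fun a ↦ ?_
  obtain ⟨b, hb⟩ := h.extOneVanishes_extend hB hp (a ≫ f)
  obtain ⟨c, hc⟩ := h.desc hp (b ≫ g) (by rw [reassoc_of% hb, hS.zero, comp_zero])
  obtain ⟨y, hy⟩ := hM c
  obtain ⟨l, hl⟩ := hS.factor (b - p ≫ y) (by simp [hy, hc])
  have := hS.mono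
  refine ⟨l, ?_⟩
  rw [← cancel_mono f, Category.assoc, hl, Preadditive.comp_sub, hb, reassoc_of% hp.zero, zero_comp,
    sub_zero]

lemma extVanishes_sub (k : ℕ) (hS : IsRelShortExact 𝒳 f g) (hD : ExtVanishes 𝒳 k M D)
    (hB : ExtVanishes 𝒳 (k + 1) M B) : ExtVanishes 𝒳 (k + 1) M A := by
  induction k generalizing M with
  | zero =>
    obtain ⟨K, P, i, p, hP, hp⟩ := h.exists_proj_cover M
    rw [h.extVanishes_succ_iff_left _ hP hp] at hB ⊢
    refine h.extOneVanishes_sub hS hB fun x ↦ ?_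
    obtain ⟨b, hb⟩ := h.extOneVanishes_extend hD hp x
    obtain ⟨y, hy⟩ := hS.lift hP b
    exact ⟨i ≫ y, by rw [Category.assoc, hy, hb]⟩
  | succ k ih => exact fun K P i p hP hp ↦ ih (hD i p hP hp) (hB i p hP hp)

lemma extVanishes_left_sub (k : ℕ) {N : C} (hS : IsRelShortExact 𝒳 f g) (hB : ExtVanishes 𝒳 k B N)
    (hD : ExtVanishes 𝒳 (k + 1) D N) : ExtVanishes 𝒳 k A N := by
  induction k generalizing N with
  | zero =>
    obtain ⟨Y, Z, j, q, hY, hq⟩ := h.exists_inj_hull N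
    rw [h.extVanishes_succ_iff_right _ hY hq] at hD
    refine h.extOneVanishes_of_hull hY hq fun x ↦ ?_
    obtain ⟨b, hb⟩ := h.extOneVanishes_extend hD hS x
    obtain ⟨y, hy⟩ := hB j q hq b
    exact ⟨f ≫ y, by rw [Category.assoc, hy, hb]⟩
  | succ k ih =>
    obtain ⟨Y, Z, j, q, hY, hq⟩ := h.exists_inj_hull N
    rw [h.extVanishes_succ_iff_right _ hY hq] at hB hD ⊢
    exact ih hB hD

lemma extOneVanishes_left_middle (hS : IsRelShortExact 𝒳 f g) (hA : ExtOneVanishes 𝒳 A N)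
    (hD : ExtOneVanishes 𝒳 D N) : ExtOneVanishes 𝒳 B N := by
  obtain ⟨Y, Z, j, q, hY, hq⟩ := h.exists_inj_hull N
  refine h.extOneVanishes_of_hull hY hq fun x ↦ ?_
  obtain ⟨y, hy⟩ := hA j q hq (f ≫ x)
  obtain ⟨b, hb⟩ := h.extend_of_mem hY hS y
  obtain ⟨c, hc⟩ := h.desc hS (x - b ≫ q) (by
    rw [Preadditive.comp_sub, reassoc_of% hb, hy, sub_self])
  obtain ⟨d, hd⟩ := hD j q hq c
  exact ⟨b + g ≫ d, by rw [Preadditive.add_comp, Category.assoc, hd, hc, add_sub_cancel]⟩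

/-! ### Comparison with the cohomological definition -/

lemma isZero_relExt_succ_iff (k : ℕ) (M N : C) :
    IsZero (relExt h (k + 1) M N) ↔ ExtVanishes 𝒳 k M N := by
  let P := h.resolution M
  have s (j : ℕ) := isRelShortExact_cycles_chain (P.acyclic j)
  have hk : ExtVanishes 𝒳 k M N ↔ ExtVanishes 𝒳 0 (P.complex.cycles k) N := by
    -- The induction step uses the hypothesis at `j + 1`, hence the general `j`.
    have (j : ℕ) : ExtVanishes 𝒳 (k + j) M N ↔ ExtVanishes 𝒳 j (P.complex.cycles k) N := by
      induction k generalizing j with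
      | zero =>
        let e : P.complex.cycles 0 ≅ M := cyclesZeroIso P.complex ≪≫ P.iso
        rw [zero_add]
        exact ⟨fun H ↦ h.extVanishes_retract j H _ _ e.hom_inv_id,
          fun H ↦ h.extVanishes_retract j H _ _ e.inv_hom_id⟩
      | succ k ih =>
        rw [add_right_comm, add_assoc, ih, h.extVanishes_succ_iff_left j (P.mem k) (s k)]
    exact this 0
  -- Deleting `M` lowers degrees by one and is invisible in positive degrees.
  have hd : (homInto P.deleted N).ExactAt (k + 1) ↔ (homInto P.complex N).ExactAt (k + 2) := by
    rw [homInto_exactAt_iff P.deleted N k (k + 1) (k + 2) (by simp) (by simp),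
      homInto_exactAt_iff P.complex N (k + 1) (k + 2) (k + 3) (by simp) (by simp)]
    rfl
  rw [hk, relExt, ← HomologicalComplex.exactAt_iff_isZero_homology, hd,
    h.homInto_exactAt_succ_iff (P.acyclic (k + 1)) (P.acyclic (k + 2))]
  exact (h.extOneVanishes_iff_extend (P.mem k) (s k)).symm

lemma relPerp_iff (T N : C) : relPerp h T N ↔ ∀ k, ExtVanishes 𝒳 k T N := by
  simp only [← h.isZero_relExt_succ_iff]
  refine ⟨fun H k ↦ H (k + 1) (by lia), fun H i hi ↦ ?_⟩
  obtain ⟨k, rfl⟩ := Nat.exists_eq_add_of_le' hi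
  exact H k

end IsAdmissibleBalancedPair

/-! ### Long exact sequences cut into short ones -/

/-- `HasLeftChain 𝒳 ℬ 𝒬 n L`: there is an `𝒳`-exact sequence
`0 ⟶ K ⟶ Qₙ ⟶ ⋯ ⟶ Q₁ ⟶ L ⟶ 0` with `K ∈ ℬ` and all `Qᵢ ∈ 𝒬`. -/
def HasLeftChain (𝒳 ℬ 𝒬 : ObjectProperty C) : ℕ → C → Prop
  | 0, L => ℬ L
  | n + 1, L => ∃ (K Q : C) (f : K ⟶ Q) (g : Q ⟶ L), IsRelShortExact 𝒳 f g ∧ 𝒬 Q ∧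
      HasLeftChain 𝒳 ℬ 𝒬 n K

/-- `HasRightChain 𝒳 𝒬 n A`: there is an `𝒳`-exact sequence
`0 ⟶ A ⟶ Q₁ ⟶ ⋯ ⟶ Qₙ ⟶ 0` with all `Qᵢ ∈ 𝒬`. -/
def HasRightChain (𝒳 𝒬 : ObjectProperty C) : ℕ → C → Prop
  | 0, A => IsZero A
  | n + 1, A => ∃ (Q D : C) (f : A ⟶ Q) (g : Q ⟶ D), IsRelShortExact 𝒳 f g ∧ 𝒬 Q ∧
      HasRightChain 𝒳 𝒬 n D

variable {ℬ 𝒬 : ObjectProperty C}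

lemma HasLeftChain.of_iso {n : ℕ} {L L' : C} (hL : HasLeftChain 𝒳 ℬ 𝒬 n L) (e : L ≅ L')
    (hℬ : ∀ ⦃A B : C⦄, (A ≅ B) → ℬ A → ℬ B) : HasLeftChain 𝒳 ℬ 𝒬 n L' := by
  cases n with
  | zero => exact hℬ e hL
  | succ n =>
    obtain ⟨K, Q, f, g, hS, hQ, hK⟩ := hL
    exact ⟨K, Q, f, g ≫ e.hom, hS.comp_iso e, hQ, hK⟩

lemma HasRightChain.of_iso {n : ℕ} {A A' : C} (hA : HasRightChain 𝒳 𝒬 n A) (e : A ≅ A') :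
    HasRightChain 𝒳 𝒬 n A' := by
  cases n with
  | zero => exact IsZero.of_iso hA e.symm
  | succ n =>
    obtain ⟨Q, D, f, g, hS, hQ, hD⟩ := hA
    exact ⟨Q, D, e.inv ≫ f, g, hS.iso_comp e.symm, hQ, hD⟩

lemma hasLeftChain_of_chainComplex (K : ChainComplex C ℕ) (n j : ℕ)
    (hQ : ∀ i, j ≤ i → i < j + n → 𝒬 (K.X (i + 1)))
    (hK : ∀ i, j ≤ i → i < j + n → HomFromExactAt 𝒳 K i) (hℬ : ℬ (K.cycles (j + n))) :
    HasLeftChain 𝒳 ℬ 𝒬 n (K.cycles j) := by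
  induction n generalizing j with
  | zero => exact hℬ
  | succ n ih =>
    refine ⟨_, _, _, _, isRelShortExact_cycles_chain (hK j le_rfl (by lia)),
      hQ j le_rfl (by lia), ih (j + 1) (fun i _ _ ↦ hQ i (by lia) (by lia))
        (fun i _ _ ↦ hK i (by lia) (by lia)) ?_⟩
    rwa [add_right_comm, add_assoc]

lemma hasRightChain_of_cochainComplex (K : CochainComplex C ℕ) (n j : ℕ)
    (hQ : ∀ i, j ≤ i → i < j + n → 𝒬 (K.X i))
    (hK : ∀ i, j < i → i ≤ j + n → HomFromExactAt 𝒳 K i) (h0 : IsZero (K.X (j + n))) :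
    HasRightChain 𝒳 𝒬 n (K.cycles j) := by
  induction n generalizing j with
  | zero => exact h0.of_mono (K.iCycles j)
  | succ n ih =>
    refine ⟨_, _, _, _, isRelShortExact_cycles (i := j) (j := j + 1) (by simp) rfl
      (hK _ (by lia) (by lia)), hQ j le_rfl (by lia), ih (j + 1) (fun i _ _ ↦ hQ i (by lia) (by lia))
        (fun i _ _ ↦ hK i (by lia) (by lia)) ?_⟩
    rwa [add_right_comm, add_assoc]

lemma homFromExactAt_of_isZero {ι : Type} {c : ComplexShape ι} {K : HomologicalComplex C c} {i : ι}
    (hi : IsZero (K.X i)) : HomFromExactAt 𝒳 K i := by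
  rw [homFromExactAt_iff 𝒳 K _ i _ rfl rfl]
  exact fun W _ x _ ↦ ⟨0, hi.eq_of_tgt _ _⟩

/-- Splicing. The last clause separates resolutions from presentations: exactness at the final term
is claimed only when the remaining kernel vanishes. -/
lemma HasLeftChain.exists_chainComplex {n : ℕ} {L : C} (hL : HasLeftChain 𝒳 ℬ 𝒬 n L) :
    ∃ K : ChainComplex C ℕ, Nonempty (K.X 0 ≅ L) ∧ (∀ i, i < n → 𝒬 (K.X (i + 1))) ∧
      (∀ i, n < i → IsZero (K.X i)) ∧ (∀ i, i < n → HomFromExactAt 𝒳 K i) ∧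
      ((∀ Z, ℬ Z → IsZero Z) → HomFromExactAt 𝒳 K n) := by
  induction n generalizing L with
  | zero =>
    refine ⟨(ChainComplex.single₀ C).obj L, ⟨Iso.refl _⟩, fun i hi ↦ by lia, fun i hi ↦ ?_,
      fun i hi ↦ by lia, fun H ↦ homFromExactAt_of_isZero (H _ hL)⟩
    exact HomologicalComplex.isZero_single_obj_X _ _ _ _ (by lia)
  | succ n ih =>
    obtain ⟨A, Q, f, g, hS, hQ, hA⟩ := hL
    obtain ⟨K, ⟨e⟩, hK, hK0, hex, hbase⟩ := ih hA
    -- The kernel `A` in degree `0` is replaced by `Q`, into which it embeds, and `L` is put in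
    -- front.
    let d : K.X 1 ⟶ Q := K.d 1 0 ≫ e.hom ≫ f
    have hd : K.d 2 1 ≫ d = 0 := by simp [d]
    let K₁ := ChainComplex.augment (ChainComplex.truncate.obj K) d hd
    have hdg : d ≫ g = 0 := by simp [d, hS.zero]
    let K₂ := ChainComplex.augment K₁ g hdg
    have := hS.mono
    have key (i : ℕ) (hi : HomFromExactAt 𝒳 K i) : HomFromExactAt 𝒳 K₂ (i + 1) := by
      match i with
      | 0 =>
        rw [homFromExactAt_iff 𝒳 K 1 0 0 (by simp) (by simp)] at hi
        rw [homFromExactAt_iff 𝒳 K₂ 2 1 0 (by simp) (by simp)]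
        intro W hW x hx
        obtain ⟨l, hl⟩ := hS.factor x hx
        obtain ⟨y, hy⟩ := hi hW (l ≫ e.inv) (by simp)
        refine ⟨y, show y ≫ K.d 1 0 ≫ e.hom ≫ f = x from ?_⟩
        rw [reassoc_of% hy, e.inv_hom_id_assoc, hl]
      | 1 =>
        rw [homFromExactAt_iff 𝒳 K 2 1 0 (by simp) (by simp)] at hi
        rw [homFromExactAt_iff 𝒳 K₂ 3 2 1 (by simp) (by simp)]
        intro W hW (x : W ⟶ K.X 1) (hx : x ≫ K.d 1 0 ≫ e.hom ≫ f = 0)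
        refine hi hW x ?_
        rw [← cancel_mono (e.hom ≫ f), zero_comp, Category.assoc, hx]
      | i + 2 =>
        rw [homFromExactAt_iff 𝒳 K (i + 3) (i + 2) (i + 1) (by simp) (by simp)] at hi
        rw [homFromExactAt_iff 𝒳 K₂ (i + 4) (i + 3) (i + 2) (by simp) (by simp)]
        exact hi
    refine ⟨K₂, ⟨Iso.refl _⟩, ?_, ?_, ?_, fun H ↦ key n (hbase H)⟩
    · rintro (_ | i) hi
      · exact hQ
      · exact hK i (by lia)
    · rintro (_ | _ | i) hi
      · lia
      · lia
      · exact hK0 (i + 1) (by lia)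
    · rintro (_ | i) hi
      · rw [homFromExactAt_iff 𝒳 K₂ 1 0 0 (by simp) (by simp)]
        exact fun W hW x _ ↦ hS.lift hW x
      · exact key i (hex i (by lia))

lemma HasRightChain.exists_cochainComplex {n : ℕ} {A : C} (hA : HasRightChain 𝒳 𝒬 n A) :
    ∃ K : CochainComplex C ℕ, Nonempty (K.X 0 ≅ A) ∧ (∀ i, i < n → 𝒬 (K.X (i + 1))) ∧
      (∀ i, n ≤ i → IsZero (K.X (i + 1))) ∧ HomFromAcyclic 𝒳 K := by
  induction n generalizing A with
  | zero =>
    refine ⟨(CochainComplex.single₀ C).obj A, ⟨Iso.refl _⟩, fun i hi ↦ by lia, fun i hi ↦ ?_,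
      fun i ↦ homFromExactAt_of_isZero ?_⟩
    · exact HomologicalComplex.isZero_single_obj_X _ _ _ _ (by lia)
    · obtain rfl | hi := eq_or_ne i 0
      · exact hA
      · exact HomologicalComplex.isZero_single_obj_X _ _ _ _ hi
  | succ n ih =>
    obtain ⟨Q, D, f, g, hS, hQ, hD⟩ := hA
    obtain ⟨K, ⟨e⟩, hK, hK0, hex⟩ := ih hD
    let d : Q ⟶ K.X 1 := g ≫ e.inv ≫ K.d 0 1
    have hd : d ≫ K.d 1 2 = 0 := by simp [d]
    let K₁ := CochainComplex.augment (CochainComplex.truncate.obj K) d hd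
    have hdg : f ≫ d = 0 := by simp [d, reassoc_of% hS.zero]
    let K₂ := CochainComplex.augment K₁ f hdg
    have := hS.mono
    refine ⟨K₂, ⟨Iso.refl _⟩, ?_, ?_, ?_⟩
    · rintro (_ | i) hi
      · exact hQ
      · exact hK i (by lia)
    · rintro (_ | i) hi
      · lia
      · exact hK0 i (by lia)
    · intro i
      match i with
      | 0 =>
        rw [homFromExactAt_iff 𝒳 K₂ 0 0 1 (by simp) (by simp)]
        intro W hW (x : W ⟶ A) (hx : x ≫ f = 0)
        obtain rfl : x = 0 := by rw [← cancel_mono f, hx, zero_comp]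
        exact ⟨0, zero_comp⟩
      | 1 =>
        have hi := (homFromExactAt_iff 𝒳 K 0 0 1 (by simp) (by simp)).1 (hex 0)
        rw [homFromExactAt_iff 𝒳 K₂ 0 1 2 (by simp) (by simp)]
        intro W hW (x : W ⟶ Q) (hx : x ≫ g ≫ e.inv ≫ K.d 0 1 = 0)
        obtain ⟨y, hy⟩ := hi hW (x ≫ g ≫ e.inv) (by simpa only [Category.assoc] using hx)
        refine hS.factor x ?_
        rw [← cancel_mono e.inv, Category.assoc, ← hy, K.shape _ _ (by simp), comp_zero, zero_comp]
      | 2 =>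
        have hi := (homFromExactAt_iff 𝒳 K 0 1 2 (by simp) (by simp)).1 (hex 1)
        rw [homFromExactAt_iff 𝒳 K₂ 1 2 3 (by simp) (by simp)]
        intro W hW x hx
        obtain ⟨y, hy⟩ := hi hW x hx
        obtain ⟨z, hz⟩ := hS.lift hW (y ≫ e.hom)
        refine ⟨z, show z ≫ g ≫ e.inv ≫ K.d 0 1 = x from ?_⟩
        rw [reassoc_of% hz, e.hom_inv_id_assoc, hy]
      | i + 3 =>
        have hi := (homFromExactAt_iff 𝒳 K (i + 1) (i + 2) (i + 3) (by simp) (by simp)).1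
          (hex (i + 2))
        rw [homFromExactAt_iff 𝒳 K₂ (i + 2) (i + 3) (i + 4) (by simp) (by simp)]
        exact hi

/-! ### Summands, pullbacks and compositions -/

/-- A retract is a direct summand. -/
def isoBiprodKernel {A B : C} (i : A ⟶ B) (r : B ⟶ A) (hi : i ≫ r = 𝟙 A) : B ≅ A ⊞ kernel r where
  hom := biprod.lift r (kernel.lift r (𝟙 B - r ≫ i) (by simp [hi]))
  inv := biprod.desc i (kernel.ι r)
  hom_inv_id := by simp [biprod.lift_desc]
  inv_hom_id := by
    apply biprod.hom_ext' <;> apply biprod.hom_ext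
    · simp [hi]
    · rw [← cancel_mono (kernel.ι r)]; simp [reassoc_of% hi]
    · simp
    · rw [← cancel_mono (kernel.ι r)]; simp

namespace IsRelShortExact

lemma zero_id {Z : C} (hZ : IsZero Z) (A : C) : IsRelShortExact 𝒳 (0 : Z ⟶ A) (𝟙 A) where
  zero := zero_comp
  mono := ⟨fun _ _ _ ↦ hZ.eq_of_tgt _ _⟩
  factor W k hk := ⟨0, by rw [zero_comp, ← hk, Category.comp_id]⟩
  lift W hW x := ⟨x, Category.comp_id x⟩

lemma id_zero {Z : C} (hZ : IsZero Z) (A : C) : IsRelShortExact 𝒳 (𝟙 A) (0 : A ⟶ Z) where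
  zero := comp_zero
  mono := inferInstance
  factor _ k _ := ⟨k, Category.comp_id k⟩
  lift _ _ _ := ⟨0, hZ.eq_of_tgt _ _⟩

lemma biprod_right {A B D : C} {f : A ⟶ B} {g : B ⟶ D} (hS : IsRelShortExact 𝒳 f g) (E : C) :
    IsRelShortExact 𝒳 (biprod.map f (𝟙 E)) (biprod.fst ≫ g) where
  zero := by simp [hS.zero]
  mono := by have := hS.mono; infer_instance
  factor W k hk := by
    obtain ⟨l, hl⟩ := hS.factor (k ≫ biprod.fst) (by simpa using hk)
    exact ⟨biprod.lift l (k ≫ biprod.snd), by ext <;> simp [hl]⟩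
  lift W hW x := by
    obtain ⟨y, hy⟩ := hS.lift hW x
    exact ⟨y ≫ biprod.inl, by simp [hy]⟩

/-- The pullback of two relative short exact sequences with the same cokernel. -/
lemma exists_pullback {A B D A' B' : C} {f : A ⟶ B} {g : B ⟶ D} {f' : A' ⟶ B'} {g' : B' ⟶ D}
    (hS : IsRelShortExact 𝒳 f g) (hS' : IsRelShortExact 𝒳 f' g') :
    ∃ (P : C) (i : A ⟶ P) (p' : P ⟶ B') (i' : A' ⟶ P) (p : P ⟶ B),
      IsRelShortExact 𝒳 i p' ∧ IsRelShortExact 𝒳 i' p := by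
  have := hS.mono
  have := hS'.mono
  refine ⟨pullback g g', pullback.lift f 0 (by simp [hS.zero]), pullback.snd g g',
    pullback.lift 0 f' (by simp [hS'.zero]), pullback.fst g g', ?_, ?_⟩
  · exact
      { zero := pullback.lift_snd _ _ _
        mono := mono_of_mono_fac (pullback.lift_fst _ _ _)
        factor := fun W k hk ↦ by
          obtain ⟨l, hl⟩ := hS.factor (k ≫ pullback.fst g g') (by
            rw [Category.assoc, pullback.condition, reassoc_of% hk, zero_comp])
          exact ⟨l, pullback.hom_ext (by rw [Category.assoc, pullback.lift_fst, hl])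
            (by rw [Category.assoc, pullback.lift_snd, hk, comp_zero])⟩
        lift := fun W hW x ↦ by
          obtain ⟨y, hy⟩ := hS.lift hW (x ≫ g')
          exact ⟨pullback.lift y x hy, pullback.lift_snd _ _ _⟩ }
  · exact
      { zero := pullback.lift_fst _ _ _
        mono := mono_of_mono_fac (pullback.lift_snd _ _ _)
        factor := fun W k hk ↦ by
          obtain ⟨l, hl⟩ := hS'.factor (k ≫ pullback.snd g g') (by
            rw [Category.assoc, ← pullback.condition, reassoc_of% hk, zero_comp])
          exact ⟨l, pullback.hom_ext (by rw [Category.assoc, pullback.lift_fst, hk, comp_zero])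
            (by rw [Category.assoc, pullback.lift_snd, hl])⟩
        lift := fun W hW x ↦ by
          obtain ⟨y, hy⟩ := hS'.lift hW (x ≫ g)
          exact ⟨pullback.lift x y hy.symm, pullback.lift_fst _ _ _⟩ }

/-- The kernel of a composition of two relative epimorphisms. -/
lemma exists_comp {A B D K L : C} {j : A ⟶ B} {q : B ⟶ D} {f : K ⟶ D} {g : D ⟶ L}
    (hq : IsRelShortExact 𝒳 j q) (hg : IsRelShortExact 𝒳 f g) :
    ∃ (Q : C) (i : Q ⟶ B) (s : A ⟶ Q) (t : Q ⟶ K),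
      IsRelShortExact 𝒳 i (q ≫ g) ∧ IsRelShortExact 𝒳 s t := by
  have := hq.mono
  have := hg.mono
  obtain ⟨t, ht⟩ := hg.factor (kernel.ι (q ≫ g) ≫ q) (by rw [Category.assoc, kernel.condition])
  let s := kernel.lift (q ≫ g) j (by rw [reassoc_of% hq.zero, zero_comp])
  have hs : s ≫ kernel.ι (q ≫ g) = j := kernel.lift_ι _ _ _
  refine ⟨_, _, s, t, .of_kernel (q ≫ g) fun W hW x ↦ ?_, ?_⟩
  · obtain ⟨y, hy⟩ := hg.lift hW x
    obtain ⟨z, hz⟩ := hq.lift hW y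
    exact ⟨z, by rw [reassoc_of% hz, hy]⟩
  · exact
      { zero := by rw [← cancel_mono f, Category.assoc, ht, reassoc_of% hs, hq.zero, zero_comp]
        mono := mono_of_mono_fac hs
        factor := fun W k hk ↦ by
          obtain ⟨l, hl⟩ := hq.factor (k ≫ kernel.ι (q ≫ g)) (by
            rw [Category.assoc, ← ht, reassoc_of% hk, zero_comp])
          exact ⟨l, by rw [← cancel_mono (kernel.ι (q ≫ g)), Category.assoc, hs, hl]⟩
        lift := fun W hW x ↦ by
          obtain ⟨y, hy⟩ := hq.lift hW (x ≫ f)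
          refine ⟨kernel.lift _ y (by rw [reassoc_of% hy, hg.zero, comp_zero]), ?_⟩
          rw [← cancel_mono f, Category.assoc, ht, kernel.lift_ι_assoc, hy] }

end IsRelShortExact

/-- The class of objects orthogonal to `T`. -/
def extPerp (𝒳 : ObjectProperty C) (T : C) : ObjectProperty C :=
  fun N ↦ ∀ k, ExtVanishes 𝒳 k T N

lemma HasLeftChain.mono {ℬ 𝒬 𝒬' : ObjectProperty C} (h𝒬 : ∀ Q, 𝒬 Q → 𝒬' Q) {n : ℕ} {L : C}
    (hL : HasLeftChain 𝒳 ℬ 𝒬 n L) : HasLeftChain 𝒳 ℬ 𝒬' n L := by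
  induction n generalizing L with
  | zero => exact hL
  | succ n ih =>
    obtain ⟨K, Q, f, g, hS, hQ, hK⟩ := hL
    exact ⟨K, Q, f, g, hS, h𝒬 Q hQ, ih hK⟩

lemma hasLeftChain_of_forall_extPerp {T : C} {𝒬 : ObjectProperty C}
    (hT : ∀ M, extPerp 𝒳 T M → ∃ (K Q : C) (f : K ⟶ Q) (g : Q ⟶ M),
      IsRelShortExact 𝒳 f g ∧ 𝒬 Q ∧ extPerp 𝒳 T K) (n : ℕ) {M : C} (hM : extPerp 𝒳 T M) :
    HasLeftChain 𝒳 (fun _ ↦ True) 𝒬 n M := by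
  induction n generalizing M with
  | zero => trivial
  | succ n ih =>
    obtain ⟨K, Q, f, g, hS, hQ, hK⟩ := hT M hM
    exact ⟨K, Q, f, g, hS, hQ, ih hK⟩

/-! ### Dimension, orthogonality and approximation -/

namespace IsAdmissibleBalancedPair

variable (h : IsAdmissibleBalancedPair 𝒳 𝒴)

include h

lemma leftDim_le_iff (n : ℕ) (M : C) :
    leftDim 𝒳 M ≤ n ↔ HasLeftChain 𝒳 (fun Z ↦ IsZero Z) 𝒳 (n + 1) M := by
  constructor
  · intro H
    -- The infimum is finite, hence attained, by a resolution possibly shorter than `n`.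
    have hne : {m : ℕ∞ | ∃ n : ℕ, m = (n : ℕ∞) ∧
        ∃ P : LeftResolution 𝒳 M, ∀ i, n < i → IsZero (P.deleted.X i)}.Nonempty := by
      by_contra hne
      rw [Set.not_nonempty_iff_eq_empty] at hne
      rw [leftDim, hne, sInf_empty] at H
      exact absurd H (by simp)
    obtain ⟨m, hm, P, hP⟩ := csInf_mem hne
    have hmn : m ≤ n := by
      rw [leftDim, hm] at H
      exact_mod_cast H
    refine (hasLeftChain_of_chainComplex P.complex (n + 1) 0 (fun i _ _ ↦ P.mem i)
      (fun i _ _ ↦ P.acyclic i) ?_).of_iso (cyclesZeroIso P.complex ≪≫ P.iso)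
      fun A B e hA ↦ IsZero.of_iso hA e.symm
    rw [zero_add]
    have := h.epi (isRelShortExact_cycles_chain (P.acyclic (n + 1)))
    exact IsZero.of_epi (P.complex.toCycles (n + 2) (n + 1)) (hP (n + 1) (by lia))
  · intro H
    obtain ⟨K, ⟨e⟩, hK, hK0, hex, hbase⟩ := H.exists_chainComplex
    refine sInf_le ⟨n, rfl, ⟨K, e, fun i ↦ ?_, fun i ↦ ?_⟩, fun i hi ↦ hK0 (i + 1) (by lia)⟩
    · by_cases hi : i < n + 1
      · exact hK i hi
      · exact h.additive_left.zero_mem (hK0 _ (by lia))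
    · obtain hi | rfl | hi := lt_trichotomy i (n + 1)
      · exact hex i hi
      · exact hbase fun _ hZ ↦ hZ
      · exact homFromExactAt_of_isZero (hK0 i hi)

lemma extVanishes_of_isZero (k : ℕ) {Z : C} (hZ : IsZero Z) (N : C) : ExtVanishes 𝒳 k Z N :=
  h.extVanishes_of_mem k (h.additive_left.zero_mem hZ) N

/-- A chain with `n + 1` terms has length `n`, so `Ext^i` vanishes from `i = n + 1` on, which is
index `n` of `ExtVanishes`. -/
lemma extVanishes_of_hasLeftChain {n : ℕ} {M : C}
    (hM : HasLeftChain 𝒳 (fun Z ↦ IsZero Z) 𝒳 (n + 1) M) (k : ℕ) (N : C) :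
    ExtVanishes 𝒳 (k + n) M N := by
  induction n generalizing M with
  | zero =>
    obtain ⟨K, P, i, p, hS, hP, hK⟩ := hM
    cases k with
    | zero => exact h.extOneVanishes_of_extend hP hS fun a ↦ ⟨0, IsZero.eq_of_src hK _ _⟩
    | succ k =>
      exact (h.extVanishes_succ_iff_left k hP hS).2 (h.extVanishes_of_isZero k hK N)
  | succ n ih =>
    obtain ⟨K, P, i, p, hS, hP, hK⟩ := hM
    exact (h.extVanishes_succ_iff_left (k + n) hP hS).2 (ih hK)

/-- Let `L` have an `n`-step resolution by objects orthogonal to `T`. If `Ext^i(T, -) = 0` for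
`i > n`, then `L` is orthogonal to `T`. -/
lemma extVanishes_of_hasLeftChain_extPerp {n : ℕ} {T L : C} {ℬ : ObjectProperty C}
    (hL : HasLeftChain 𝒳 ℬ (extPerp 𝒳 T) n L) (k : ℕ)
    (hT : ∀ N, ExtVanishes 𝒳 (k + n) T N) : ExtVanishes 𝒳 k T L := by
  induction n generalizing L k with
  | zero => exact hT L
  | succ n ih =>
    obtain ⟨K, Q, f, g, hS, hQ, hK⟩ := hL
    refine h.extVanishes_quotient k hS (hQ k) (ih hK (k + 1) fun N ↦ ?_)
    rw [add_assoc, add_comm 1]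
    exact hT N

lemma extPerp_retract {T M M' : C} (hM : extPerp 𝒳 T M) (i : M' ⟶ M) (r : M ⟶ M')
    (hi : i ≫ r = 𝟙 M') : extPerp 𝒳 T M' := by
  have key (k : ℕ) (A : C) (hA : ExtVanishes 𝒳 k A M) : ExtVanishes 𝒳 k A M' := by
    induction k generalizing A with
    | zero =>
      obtain ⟨K, P, j, p, hP, hp⟩ := h.exists_proj_cover A
      refine h.extOneVanishes_of_extend hP hp fun a ↦ ?_
      obtain ⟨b, hb⟩ := h.extOneVanishes_extend hA hp (a ≫ i)
      exact ⟨b ≫ r, by rw [reassoc_of% hb, hi, Category.comp_id]⟩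
    | succ k ih => exact fun K P j p hP hp ↦ ih K (hA j p hP hp)
  exact fun k ↦ key k T (hM k)

/-- Only the first step changes: the pullback of `Q ⟶ D` along `g` is an extension of `Q` by `A`,
hence orthogonal, and its kernel over `B` is still `K`. -/
lemma hasLeftChain_extension {n : ℕ} {T A B D : C} {f : A ⟶ B} {g : B ⟶ D}
    (hS : IsRelShortExact 𝒳 f g) (hA : extPerp 𝒳 T A)
    (hD : HasLeftChain 𝒳 (fun _ ↦ True) (extPerp 𝒳 T) n D) :
    HasLeftChain 𝒳 (fun _ ↦ True) (extPerp 𝒳 T) n B := by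
  cases n with
  | zero => trivial
  | succ n =>
    obtain ⟨K, Q, i, p, hp, hQ, hK⟩ := hD
    obtain ⟨P, i₁, p₁, i₂, p₂, h₁, h₂⟩ := hS.exists_pullback hp
    exact ⟨K, P, i₂, p₂, h₂, fun k ↦ h.extVanishes_middle k h₁ (hA k) (hQ k), hK⟩

/-- Covering the first term `M` by `Q` enlarges the kernel `K` to an extension of `K` by the
orthogonal object `M'`, which `hasLeftChain_extension` absorbs. -/
lemma hasLeftChain_of_extPerp {n : ℕ} {T L : C} {𝒬 : ObjectProperty C}
    (hT : ∀ M, extPerp 𝒳 T M → ∃ (K Q : C) (f : K ⟶ Q) (g : Q ⟶ M),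
      IsRelShortExact 𝒳 f g ∧ 𝒬 Q ∧ extPerp 𝒳 T K)
    (hL : HasLeftChain 𝒳 (fun _ ↦ True) (extPerp 𝒳 T) n L) :
    HasLeftChain 𝒳 (fun _ ↦ True) 𝒬 n L := by
  induction n generalizing L with
  | zero => trivial
  | succ n ih =>
    obtain ⟨K, M, f, g, hS, hM, hK⟩ := hL
    obtain ⟨M', Q, j, q, hq, hQ, hM'⟩ := hT M hM
    obtain ⟨R, i, s, t, hi, hs⟩ := hq.exists_comp hS
    exact ⟨R, Q, i, q ≫ g, hi, hQ, ih (h.hasLeftChain_extension hs hM' hK)⟩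

/-- If all objects with an `n`-step resolution by objects orthogonal to `T` are orthogonal to `T`,
then `Ext^i(T, -) = 0` for `i > n`. -/
lemma extVanishes_of_forall_hasLeftChain {n : ℕ} {T : C}
    (hn : ∀ L, HasLeftChain 𝒳 (fun _ ↦ True) (extPerp 𝒳 T) n L → extPerp 𝒳 T L)
    (k : ℕ) (N : C) : ExtVanishes 𝒳 (k + n) T N := by
  -- Each cosyzygy lowers the degree `m` and gains one presentation step `j`, as its hull in `𝒴` is
  -- orthogonal to `T`.
  have (m j : ℕ) (hmj : m + j = n) (N : C)
      (hN : HasLeftChain 𝒳 (fun _ ↦ True) (extPerp 𝒳 T) j N) : ExtVanishes 𝒳 (k + m) T N := by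
    induction m generalizing j N with
    | zero =>
      obtain rfl : j = n := by lia
      exact hn N hN k
    | succ m ih =>
      obtain ⟨Y, Z, i, q, hY, hq⟩ := h.exists_inj_hull N
      exact (h.extVanishes_succ_iff_right (k + m) hY hq).2 (ih (j + 1) (by lia) Z
        ⟨N, Y, i, q, hq, fun k ↦ h.extVanishes_right_of_mem k hY T, hN⟩)
  exact this n 0 rfl N trivial

/-- Auslander–Buchweitz approximation by objects orthogonal to `T`. -/
lemma exists_approximation {T : C} {𝒬 : ObjectProperty C}
    (hT : ∀ M, extPerp 𝒳 T M → ∃ (K Q : C) (f : K ⟶ Q) (g : Q ⟶ M),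
      IsRelShortExact 𝒳 f g ∧ 𝒬 Q ∧ extPerp 𝒳 T K) (n : ℕ) (N : C)
    (hN : ∀ k, ExtVanishes 𝒳 (k + n) T N) :
    ∃ (M D : C) (f : N ⟶ M) (g : M ⟶ D), IsRelShortExact 𝒳 f g ∧ extPerp 𝒳 T M ∧
      HasRightChain 𝒳 𝒬 n D := by
  induction n generalizing N with
  | zero => exact ⟨N, 0, 𝟙 N, 0, .id_zero (isZero_zero C) N, hN, isZero_zero C⟩
  | succ n ih =>
    obtain ⟨Y, Z, i, q, hY, hq⟩ := h.exists_inj_hull N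
    obtain ⟨M, D, f, g, hS, hM, hD⟩ :=
      ih Z fun k ↦ (h.extVanishes_succ_iff_right (k + n) hY hq).1 (hN k)
    obtain ⟨M', Q, j, p, hp, hQ, hM'⟩ := hT M hM
    -- `R` is the kernel of `Q ⟶ D`, so it has a coresolution one step longer. Pulling `Y` and `R`
    -- back over `Z` gives `P`, an extension of `Y` by `M'` containing `N` with cokernel `R`.
    obtain ⟨R, a, s, t, ha, hs⟩ := hp.exists_comp hS
    obtain ⟨P, i₁, p₁, i₂, p₂, h₁, h₂⟩ := hq.exists_pullback hs
    exact ⟨P, R, i₁, p₁, h₁, fun k ↦ h.extVanishes_middle k h₂ (hM' k)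
      (h.extVanishes_right_of_mem k hY T), Q, D, a, p ≫ g, ha, hQ, hD⟩

lemma extVanishes_of_hasRightChain {𝒬 : ObjectProperty C} {N : C}
    (h𝒬 : ∀ Q, 𝒬 Q → ∀ k, ExtVanishes 𝒳 k Q N) {n : ℕ} {A : C} (hA : HasRightChain 𝒳 𝒬 n A)
    (k : ℕ) : ExtVanishes 𝒳 k A N := by
  induction n generalizing A k with
  | zero => exact h.extVanishes_of_isZero k hA N
  | succ n ih =>
    obtain ⟨Q, D, f, g, hS, hQ, hD⟩ := hA
    exact h.extVanishes_left_sub k hS (h𝒬 Q hQ k) (ih hD (k + 1))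

end IsAdmissibleBalancedPair

/-! ### Coproducts, the swindle and `Add T` -/

variable [HasCoproducts.{v} C]

/-- The absorbing isomorphism `P ⊞ P^(ℕ) ≅ P^(ℕ)` of the Eilenberg swindle. -/
def biprodSigmaNatIso (P : C) :
    P ⊞ (∐ fun _ : ULift.{v} ℕ ↦ P) ≅ ∐ fun _ : ULift.{v} ℕ ↦ P where
  hom := biprod.desc (Sigma.ι (fun _ : ULift.{v} ℕ ↦ P) ⟨0⟩)
    (Sigma.desc fun n ↦ Sigma.ι (fun _ : ULift.{v} ℕ ↦ P) ⟨n.down + 1⟩)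
  inv := Sigma.desc fun n ↦ match n with
    | ⟨0⟩ => biprod.inl
    | ⟨n + 1⟩ => Sigma.ι (fun _ : ULift.{v} ℕ ↦ P) ⟨n⟩ ≫ biprod.inr
  hom_inv_id := by
    apply biprod.hom_ext'
    · simp
    · ext n : 1
      simp
  inv_hom_id := by
    ext ⟨_ | n⟩ : 1 <;> simp

lemma addClosure_iff (T M : C) : addClosure T M ↔ ∃ (I : Type v) (i : M ⟶ ∐ fun _ : I ↦ T)
    (r : (∐ fun _ : I ↦ T) ⟶ M), i ≫ r = 𝟙 M := by
  constructor
  · rintro ⟨J, I, ⟨e⟩⟩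
    exact ⟨I, biprod.inl ≫ e.hom, e.inv ≫ biprod.fst, by simp⟩
  · rintro ⟨I, i, r, hi⟩
    exact ⟨_, I, ⟨(isoBiprodKernel i r hi).symm⟩⟩

lemma addClosure_sigma (T : C) (I : Type v) : addClosure T (∐ fun _ : I ↦ T) :=
  (addClosure_iff T _).2 ⟨I, 𝟙 _, 𝟙 _, Category.comp_id _⟩

lemma addClosure.retract {T M M' : C} (hM : addClosure T M) (i : M' ⟶ M) (r : M ⟶ M')
    (hi : i ≫ r = 𝟙 M') : addClosure T M' := by
  obtain ⟨I, j, s, hj⟩ := (addClosure_iff T M).1 hM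
  exact (addClosure_iff T M').2 ⟨I, i ≫ j, s ≫ r, by simp [reassoc_of% hj, hi]⟩

lemma addClosure_zero (T : C) {Z : C} (hZ : IsZero Z) : addClosure T Z :=
  (addClosure_sigma T PEmpty).retract 0 0 (hZ.eq_of_src _ _)

lemma relPres_iff (n : ℕ) (T L : C) :
    relPres 𝒳 n T L ↔ HasLeftChain 𝒳 (fun _ ↦ True) (addClosure T) n L := by
  constructor
  · rintro ⟨K, ⟨e⟩, hK, -, hex⟩
    exact (hasLeftChain_of_chainComplex K n 0 (fun i _ _ ↦ hK (i + 1) (by lia) (by lia))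
      (fun i _ _ ↦ hex i (by lia)) trivial).of_iso (cyclesZeroIso K ≪≫ e) fun _ _ _ _ ↦ trivial
  · intro H
    obtain ⟨K, e, hK, hK0, hex, -⟩ := H.exists_chainComplex
    refine ⟨K, e, fun i hi hin ↦ ?_, hK0, hex⟩
    obtain ⟨j, rfl⟩ := Nat.exists_eq_add_of_le' hi
    exact hK j (by lia)

lemma hasLeftChain_of_addClosure (n : ℕ) {T Q : C} (hQ : addClosure T Q) :
    HasLeftChain 𝒳 (fun _ ↦ True) (addClosure T) n Q := by
  induction n generalizing Q with
  | zero => trivial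
  | succ n ih => exact ⟨0, Q, 0, 𝟙 Q, .zero_id (isZero_zero C) Q, hQ,
      ih (addClosure_zero T (isZero_zero C))⟩

namespace IsAdmissibleBalancedPair

variable (h : IsAdmissibleBalancedPair 𝒳 𝒴)

include h

/-- Relative projectives absorb into objects of `𝒳`, by the Eilenberg swindle. -/
lemma exists_biprod_mem {P : C} (hP : ∀ N, ExtOneVanishes 𝒳 P N) : ∃ X, 𝒳 X ∧ 𝒳 (P ⊞ X) := by
  let S := ∐ fun _ : ULift.{v} ℕ ↦ P
  obtain ⟨K, X, i, p, hX, hp⟩ := h.exists_proj_cover S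
  obtain ⟨s, hs⟩ := ExtOneVanishes.sigma (fun _ : ULift.{v} ℕ ↦ hP K) i p hp (𝟙 S)
  let e := isoBiprodKernel s p hs
  refine ⟨X, hX, h.additive_left.iso_mem ?_ hX⟩
  exact e ≪≫ biprod.mapIso (biprodSigmaNatIso P).symm (Iso.refl _) ≪≫ biprod.associator _ _ _ ≪≫
    biprod.mapIso (Iso.refl P) e.symm

/-- The last syzygy is relatively projective, but `𝒳` need not be closed under summands. Adding a
suitable `X` to it and to the preceding term repairs this; having a preceding term requires positive
length. -/
lemma hasLeftChain_of_extVanishes {n : ℕ} {M : C} (hM : ∀ N, ExtVanishes 𝒳 (n + 1) M N) :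
    HasLeftChain 𝒳 (fun Z ↦ IsZero Z) 𝒳 (n + 2) M := by
  induction n generalizing M with
  | zero =>
    obtain ⟨K, P, i, p, hP, hp⟩ := h.exists_proj_cover M
    obtain ⟨X, hX, hKX⟩ := h.exists_biprod_mem (P := K) fun N ↦ hM N i p hP hp
    exact ⟨K ⊞ X, P ⊞ X, _, _, hp.biprod_right X, h.additive_left.biprod_mem hP hX,
      0, K ⊞ X, 0, 𝟙 _, .zero_id (isZero_zero C) _, hKX, isZero_zero C⟩
  | succ n ih =>
    obtain ⟨K, P, i, p, hP, hp⟩ := h.exists_proj_cover M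
    exact ⟨K, P, i, p, hp, hP, ih fun N ↦ hM N i p hP hp⟩

lemma extVanishes_of_addClosure {T N Q : C} (hN : extPerp 𝒳 T N) (hQ : addClosure T Q) (k : ℕ) :
    ExtVanishes 𝒳 k Q N := by
  obtain ⟨I, i, r, hi⟩ := (addClosure_iff T Q).1 hQ
  exact h.extVanishes_retract k (h.extVanishes_sigma k fun _ ↦ hN k) i r hi

lemma extPerp_of_addClosure {T Q : C} (hT : ∀ I : Type v, extPerp 𝒳 T (∐ fun _ : I ↦ T))
    (hQ : addClosure T Q) : extPerp 𝒳 T Q := by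
  obtain ⟨I, i, r, hi⟩ := (addClosure_iff T Q).1 hQ
  exact h.extPerp_retract (hT I) i r hi

/-- If maps from `𝒳` to `M` factor through `Add T`, then the evaluation `T^(Hom(T, M)) ⟶ M` is a
relative epimorphism, and its kernel is again orthogonal to `T`. -/
lemma exists_evaluation {T M : C} (hT : ∀ I : Type v, extPerp 𝒳 T (∐ fun _ : I ↦ T))
    (hM : extPerp 𝒳 T M) (hf : ∀ ⦃W : C⦄, 𝒳 W → ∀ x : W ⟶ M,
      ∃ (Q : C) (a : W ⟶ Q) (b : Q ⟶ M), addClosure T Q ∧ a ≫ b = x) :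
    ∃ (K Q : C) (f : K ⟶ Q) (g : Q ⟶ M),
      IsRelShortExact 𝒳 f g ∧ addClosure T Q ∧ extPerp 𝒳 T K := by
  let g : (∐ fun _ : T ⟶ M ↦ T) ⟶ M := Sigma.desc fun φ ↦ φ
  have hg (φ : T ⟶ M) : Sigma.ι (fun _ : T ⟶ M ↦ T) φ ≫ g = φ := by simp [g]
  have hS : IsRelShortExact 𝒳 (kernel.ι g) g := .of_kernel g fun W hW x ↦ by
    obtain ⟨Q, a, b, hQ, rfl⟩ := hf hW x
    obtain ⟨I, i, r, hi⟩ := (addClosure_iff T Q).1 hQ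
    -- Each component `T ⟶ M` of `r ≫ b` is itself an index of the source of `g`, so it factors
    -- through that summand.
    refine ⟨a ≫ i ≫ Sigma.desc fun j ↦ Sigma.ι (fun _ : T ⟶ M ↦ T)
      (Sigma.ι (fun _ : I ↦ T) j ≫ r ≫ b), ?_⟩
    have : (Sigma.desc fun j ↦ Sigma.ι (fun _ : T ⟶ M ↦ T)
        (Sigma.ι (fun _ : I ↦ T) j ≫ r ≫ b)) ≫ g = r ≫ b := by
      ext j
      simp [hg]
    rw [Category.assoc, Category.assoc, this, reassoc_of% hi]
  refine ⟨_, _, _, g, hS, addClosure_sigma T _, fun k ↦ ?_⟩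
  cases k with
  | zero => exact h.extOneVanishes_sub hS (hT _ 0) fun x ↦ ⟨_, hg x⟩
  | succ k => exact h.extVanishes_sub k hS (hM k) (hT _ (k + 1))

end IsAdmissibleBalancedPair

/-! ### The two implications -/

lemma isTilting_iff (h : IsAdmissibleBalancedPair 𝒳 𝒴) (n : ℕ) (T : C) :
    IsTilting h n T ↔ HasLeftChain 𝒳 (fun Z ↦ IsZero Z) 𝒳 (n + 1) T ∧
      (∀ I : Type v, extPerp 𝒳 T (∐ fun _ : I ↦ T)) ∧
      ∀ A, 𝒳 A → HasRightChain 𝒳 (addClosure T) (n + 1) A := by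
  constructor
  · intro H
    refine ⟨(h.leftDim_le_iff n T).1 H.dim_le, fun I k ↦
      (h.isZero_relExt_succ_iff k _ _).1 (H.selfOrthogonal I _ k.succ_pos), fun A hA ↦ ?_⟩
    obtain ⟨K, ⟨e⟩, hK, hK0, hex⟩ := H.coresolution A hA
    obtain ⟨e'⟩ := h.nonempty_cycles_one_iso (hex 0) (hex 1)
    refine (hasRightChain_of_cochainComplex K (n + 1) 1 (fun i hi hin ↦ ?_) (fun i _ _ ↦ hex i)
      ?_).of_iso (e' ≪≫ e)
    · obtain ⟨j, rfl⟩ := Nat.exists_eq_add_of_le' hi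
      exact hK j (by lia)
    · rw [add_comm]
      exact hK0 (n + 1) (by lia)
  · rintro ⟨hdim, hT, hX⟩
    refine ⟨(h.leftDim_le_iff n T).2 hdim, fun I i hi ↦ ?_, fun A hA ↦ ?_⟩
    · obtain ⟨k, rfl⟩ := Nat.exists_eq_add_of_le' hi
      exact (h.isZero_relExt_succ_iff k _ _).2 (hT I k)
    · obtain ⟨K, e, hK, hK0, hex⟩ := (hX A hA).exists_cochainComplex
      exact ⟨K, e, fun i hi ↦ hK i (by lia), fun i hi ↦ hK0 i (by lia), hex⟩

lemma IsTilting.relPres_eq {h : IsAdmissibleBalancedPair 𝒳 𝒴} {n : ℕ} {T : C}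
    (hT : IsTilting h n T) : relPres 𝒳 n T = relPerp h T := by
  obtain ⟨hdim, hself, hX⟩ := (isTilting_iff h n T).1 hT
  ext L
  rw [relPres_iff, h.relPerp_iff]
  constructor
  · intro hL k
    exact h.extVanishes_of_hasLeftChain_extPerp
      (hL.mono fun Q hQ ↦ h.extPerp_of_addClosure hself hQ) k
      (h.extVanishes_of_hasLeftChain hdim k)
  · refine hasLeftChain_of_forall_extPerp (T := T) (fun M hM ↦ ?_) n
    refine h.exists_evaluation hself hM fun W hW x ↦ ?_
    obtain ⟨Q, D, f, g, hS, hQ, hD⟩ := hX W hW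
    -- `D` is finitely coresolved by `Add T`, hence has no extensions by `M`; so `x` extends to `Q`.
    have hDM := h.extVanishes_of_hasRightChain
      (fun Q hQ ↦ h.extVanishes_of_addClosure hM hQ) hD 0
    obtain ⟨b, hb⟩ := h.extOneVanishes_extend hDM hS x
    exact ⟨Q, f, b, hQ, hb⟩

lemma isTilting_of_relPres_eq (h : IsAdmissibleBalancedPair 𝒳 𝒴) {n : ℕ} (hn : 1 ≤ n) {T : C}
    (hT : relPres 𝒳 n T = relPerp h T) : IsTilting h n T := by
  obtain ⟨n, rfl⟩ := Nat.exists_eq_add_of_le' hn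
  have H (L : C) : HasLeftChain 𝒳 (fun _ ↦ True) (addClosure T) (n + 1) L ↔ extPerp 𝒳 T L := by
    rw [← relPres_iff, hT]
    exact h.relPerp_iff T L
  have hself (I : Type v) : extPerp 𝒳 T (∐ fun _ : I ↦ T) :=
    (H _).1 (hasLeftChain_of_addClosure _ (addClosure_sigma T I))
  have hgen (M : C) (hM : extPerp 𝒳 T M) : ∃ (K Q : C) (f : K ⟶ Q) (g : Q ⟶ M),
      IsRelShortExact 𝒳 f g ∧ addClosure T Q ∧ extPerp 𝒳 T K := by
    refine h.exists_evaluation hself hM fun W hW x ↦ ?_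
    obtain ⟨K, Q, f, g, hS, hQ, -⟩ := (H M).2 hM
    obtain ⟨y, hy⟩ := hS.lift hW x
    exact ⟨Q, y, g, hQ, hy⟩
  have hdim (k : ℕ) (N : C) : ExtVanishes 𝒳 (k + (n + 1)) T N :=
    h.extVanishes_of_forall_hasLeftChain
      (fun L hL ↦ (H L).1 (h.hasLeftChain_of_extPerp hgen hL)) k N
  refine (isTilting_iff h _ T).2 ⟨h.hasLeftChain_of_extVanishes fun N ↦ ?_, hself, fun A hA ↦ ?_⟩
  · simpa using hdim 0 N
  · obtain ⟨M, D, f, g, hS, hM, hD⟩ := h.exists_approximation hgen (n + 1) A fun k ↦ hdim k A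
    obtain ⟨K, Q, i, p, hp, hQ, hK⟩ := hgen M hM
    -- `M` is an extension of `D` by `A ∈ 𝒳`, neither of which has extensions by the orthogonal `K`;
    -- so `Q ⟶ M` splits.
    have hMK : ExtOneVanishes 𝒳 M K := h.extOneVanishes_left_middle hS (extOneVanishes_of_mem hA K)
      (h.extVanishes_of_hasRightChain (fun Q hQ ↦ h.extVanishes_of_addClosure hK hQ) hD 0)
    obtain ⟨s, hs⟩ := hMK i p hp (𝟙 M)
    exact ⟨M, D, f, g, hS, hQ.retract s p hs, hD⟩

end

end RelTilting

end

open RelTilting in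
theorem theorem3p9 {C : Type u} [Category.{v} C] [Abelian C] [HasCoproducts.{v} C]
    {𝒳 𝒴 : ObjectProperty C} (h : IsAdmissibleBalancedPair 𝒳 𝒴)
    (n : ℕ) (hn : 1 ≤ n) (T : C) :
    IsTilting h n T ↔ relPres 𝒳 n T = relPerp h T := by
  exact ⟨IsTilting.relPres_eq, isTilting_of_relPres_eq h hn⟩
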